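/- Let $G$ be a commutative complex Lie group acting holomorphically on a complex manifold $X$ such that at every $x\in X$ the values of the global holomorphic vector fields on $X$ span the tangent space $T_xX$ (for example, $X$ Stein). Write $\mathscr A(X)$ for the $\mathcal O(X)$-module of holomorphic vector fields on $X$. For a character $\chi$ of $G$ (a holomorphic homomorphism $G\to\mathbb C^*$), let $\mathscr A(X)_\chi$ be the set of $\xi\in\mathscr A(X)$ with $g_*\xi=\chi(g)\xi$ for all $g\in G$, where $(g_*\xi)(x)=Dg|_{g^{-1}x}(\xi(g^{-1}x))$. A field is complete if its flow exists for all complex times. Suppose that there are complete fields $\xi_1\in\mathscr A(X)_{\chi_1},\dots,\xi_k\in\mathscr A(X)_{\chi_k}$, for some (not necessarily distinct) characters $\chi_1,\dots,\chi_k$ of $G$, which generate $\mathscr A(X)$ as an $\mathcal O(X)$-module. Then $X$ is $G$-elliptic, that is: there are a holomorphic vector bundle $E\to X$ with a lift of the $G$-action to $E$ by vector bundle isomorphisms, and a $G$-equivariant holomorphic map $s:E\to X$ with $s(0_x)=x$ such that $s|_{E_x}$ is a submersion at $0_x$ for all $x\in X$ (a dominating $G$-spray). More precisely, let $\phi_i^t$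 be the flow of $\xi_i$. On the trivial bundle $X\times\mathbb C^k$ with the $G$-action $g\cdot(x,a_1,\dots,a_k)=(gx,\chi_1(g)a_1,\dots,\chi_k(g)a_k)$, the map $s(x,a)=(\phi_1^{a_1}\circ\cdots\circ\phi_k^{a_k})(x)$ is a dominating $G$-spray. -/

import Mathlib

open scoped Manifold ContDiff Bundle

/-! Throughout, a complex manifold is a manifold over `ℂ` of class `C^ω` modelled on a
finite-dimensional complex normed space, and "holomorphic" means `C^ω` over `ℂ`. -/

section VectorFields

variable {E : Type*} [NormedAddCommGroup E] [NormedSpace ℂ E]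
  (X : Type*) [TopologicalSpace X] [ChartedSpace E X] [IsManifold 𝓘(ℂ, E) ω X]

variable (E) in
/-- Holomorphic vector fields on `X`: the holomorphic sections of the tangent bundle. -/
abbrev HolVectorField : Type _ :=
  ContMDiffSection 𝓘(ℂ, E) E ω (TangentSpace 𝓘(ℂ, E) : X → Type _)

variable (E) in
/-- Holomorphic functions on `X`. -/
abbrev HolFunction : Type _ := ContMDiffMap 𝓘(ℂ, E) 𝓘(ℂ) X ℂ ω

variable {X}

/-- The curve `γ : ℂ → X`, with complex time, is an entire integral curve of `ξ`:
it is holomorphic with `γ'(s) = ξ (γ s)` for every `s : ℂ`. -/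
def IsEntireIntegralCurve (ξ : HolVectorField E X) (γ : ℂ → X) : Prop :=
  ∀ s : ℂ, HasMFDerivAt 𝓘(ℂ) 𝓘(ℂ, E) γ s ((1 : ℂ →L[ℂ] ℂ).smulRight (ξ (γ s)))

/-- A holomorphic vector field is complete if through every point there is an integral curve
defined for all complex times. -/
def IsCompleteField (ξ : HolVectorField E X) : Prop :=
  ∀ x : X, ∃ γ : ℂ → X, γ 0 = x ∧ IsEntireIntegralCurve ξ γ

/-- `φ s x` is the flow of `ξ`, defined for all complex times `s`. -/
def IsFlowOf (ξ : HolVectorField E X) (φ : ℂ → X → X) : Prop :=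
  ∀ x : X, φ 0 x = x ∧ IsEntireIntegralCurve ξ (fun s => φ s x)

/-- The fields `ξ i` generate the module of all holomorphic vector fields on `X` over the ring of
holomorphic functions on `X`. -/
def GenerateFields {k : ℕ} (ξ : Fin k → HolVectorField E X) : Prop :=
  ∀ η : HolVectorField E X, ∃ f : Fin k → HolFunction E X,
    ∀ x : X, η x = ∑ i, f i x • ξ i x

variable (E X) in
/-- At every point of `X`, the values of the global holomorphic vector fields fill (equivalently,
span) the tangent space. -/
def FieldsSpanTangentSpaces : Prop :=
  ∀ (x : X) (v : TangentSpace 𝓘(ℂ, E) x), ∃ η : HolVectorField E X, η x = v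

/-- `G` acts on the vector field `ξ` by the character `χ`, that is, `g_* ξ = χ g • ξ` for all `g`,
where `(g_* ξ)(y) = D g (ξ (g⁻¹ • y))` (differential at `g⁻¹ • y`). The identity is written at the
point `y = g • x`. -/
def TransformsBy {G : Type*} [Group G] [MulAction G X] (χ : G →* ℂˣ)
    (ξ : HolVectorField E X) : Prop :=
  ∀ (g : G) (x : X),
    mfderiv 𝓘(ℂ, E) 𝓘(ℂ, E) (fun y : X => g • y) x (ξ x) = (χ g : ℂ) • ξ (g • x)

/-- The composition `φ₀^{a₀} ∘ φ₁^{a₁} ∘ ⋯ ∘ φ_{k-1}^{a_{k-1}}` of time-`a i` maps. -/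
def composeFlows {X : Type*} {k : ℕ} (φ : Fin k → ℂ → X → X) (a : Fin k → ℂ) : X → X :=
  (List.ofFn fun i => φ i (a i)).foldr (fun f h => f ∘ h) id

end VectorFields

section Characters

/-- A character of the complex Lie group `G` is a holomorphic homomorphism `G → ℂˣ`. -/
def IsHolCharacter {F : Type*} [NormedAddCommGroup F] [NormedSpace ℂ F]
    {G : Type*} [Group G] [TopologicalSpace G] [ChartedSpace F G] (χ : G →* ℂˣ) : Prop :=
  ContMDiff 𝓘(ℂ, F) 𝓘(ℂ) ω (fun g : G => (χ g : ℂ))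

end Characters

section Sprays

variable {E : Type*} [NormedAddCommGroup E] [NormedSpace ℂ E]
  {X : Type*} [TopologicalSpace X] [ChartedSpace E X]
  {F : Type*} [NormedAddCommGroup F] [NormedSpace ℂ F]
  {G : Type*} [Group G] [TopologicalSpace G] [ChartedSpace F G] [MulAction G X]
  {B : Type*} [NormedAddCommGroup B] [NormedSpace ℂ B]
  {V : X → Type*} [∀ x, AddCommGroup (V x)] [∀ x, Module ℂ (V x)]
  [TopologicalSpace (Bundle.TotalSpace B V)] [∀ x, TopologicalSpace (V x)]
  [FiberBundle B V]

variable (E F) in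
/-- `act` is a holomorphic action of `G` on the total space of the vector bundle `V`, which lifts
the action on the base `X` and is linear on fibres (hence acts by vector bundle isomorphisms). -/
structure IsLiftedAction (act : G → Bundle.TotalSpace B V → Bundle.TotalSpace B V) : Prop where
  one_act : ∀ e, act 1 e = e
  mul_act : ∀ g h e, act (g * h) e = act g (act h e)
  linear : ∀ (g : G) (x : X), ∃ L : V x →ₗ[ℂ] V (g • x),
    ∀ v : V x, act g ⟨x, v⟩ = ⟨g • x, L v⟩
  holomorphic : ContMDiff (𝓘(ℂ, F).prod (𝓘(ℂ, E).prod 𝓘(ℂ, B))) (𝓘(ℂ, E).prod 𝓘(ℂ, B)) ω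
    (fun p : G × Bundle.TotalSpace B V => act p.1 p.2)

variable (E) in
/-- `s` is a dominating spray on the vector bundle `V` over `X`. In `dominating`, the fibre `V x`
is identified with the model fibre `B` by a linear isomorphism (a trivialization), so the condition
says that the differential of `s|_{V x}` at `0` is surjective onto the tangent space at `x`. -/
structure IsDominatingSpray [VectorBundle ℂ B V] (s : Bundle.TotalSpace B V → X) : Prop where
  holomorphic : ContMDiff (𝓘(ℂ, E).prod 𝓘(ℂ, B)) 𝓘(ℂ, E) ω s
  zero : ∀ x : X, s ⟨x, 0⟩ = x
  dominating : ∀ x : X, Function.Surjective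
    (mfderiv 𝓘(ℂ, B) 𝓘(ℂ, E)
      (fun v : B => s ⟨x, (trivializationAt B V x).symmL ℂ x v⟩) 0)

variable (E F) in
/-- `s` is a dominating `G`-spray, with respect to the lifted action `act`. -/
structure IsDominatingGSpray [VectorBundle ℂ B V]
    (act : G → Bundle.TotalSpace B V → Bundle.TotalSpace B V)
    (s : Bundle.TotalSpace B V → X) : Prop where
  lifted : IsLiftedAction E F act
  spray : IsDominatingSpray E s
  equivariant : ∀ g e, s (act g e) = g • s e

end Sprays

/-- The `G`-manifold `X` is `G`-elliptic: there is a holomorphic vector bundle `V` on `X`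
(of finite rank `r`), a lift of the `G`-action on `X` to `V` by vector bundle isomorphisms, and a
dominating `G`-equivariant spray on the total space of `V`. -/
def IsGElliptic (E : Type*) [NormedAddCommGroup E] [NormedSpace ℂ E]
    (F : Type*) [NormedAddCommGroup F] [NormedSpace ℂ F]
    (G : Type*) [Group G] [TopologicalSpace G] [ChartedSpace F G]
    (X : Type*) [TopologicalSpace X] [ChartedSpace E X] [MulAction G X] : Prop :=
  ∃ (r : ℕ) (V : X → Type) (_ : ∀ x, AddCommGroup (V x)) (_ : ∀ x, Module ℂ (V x))
    (_ : TopologicalSpace (Bundle.TotalSpace (Fin r → ℂ) V)) (_ : ∀ x, TopologicalSpace (V x))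
    (_ : FiberBundle (Fin r → ℂ) V) (_ : VectorBundle ℂ (Fin r → ℂ) V)
    (_ : ContMDiffVectorBundle ω (Fin r → ℂ) V 𝓘(ℂ, E))
    (act : G → Bundle.TotalSpace (Fin r → ℂ) V → Bundle.TotalSpace (Fin r → ℂ) V)
    (s : Bundle.TotalSpace (Fin r → ℂ) V → X),
    IsDominatingGSpray E F act s

/-- The action of `G` on the trivial bundle `X × ℂ^k` twisted by characters `χ i`:
`g · (x, a) = (g • x, (χ i g * a i)_i)`. -/
def twistedAction {G X : Type*} [Group G] [MulAction G X] {k : ℕ} (χ : Fin k → G →* ℂˣ)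
    (g : G) (e : Bundle.TotalSpace (Fin k → ℂ) (Bundle.Trivial X (Fin k → ℂ))) :
    Bundle.TotalSpace (Fin k → ℂ) (Bundle.Trivial X (Fin k → ℂ)) :=
  ⟨g • e.1, fun i => (χ i g : ℂ) * (e.2 : Fin k → ℂ) i⟩

/-- The map `(x, a) ↦ φ₀^{a₀} ∘ ⋯ ∘ φ_{k-1}^{a_{k-1}} (x)` on the trivial bundle `X × ℂ^k`. -/
def flowSpray {X : Type*} {k : ℕ} (φ : Fin k → ℂ → X → X)
    (e : Bundle.TotalSpace (Fin k → ℂ) (Bundle.Trivial X (Fin k → ℂ))) : X :=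
  composeFlows φ (e.2 : Fin k → ℂ) e.1

/-! Everything rests on two facts about a complete holomorphic field: its entire integral curves are
unique, and its flow is jointly holomorphic in time and point.

Uniqueness gives the group law, and also `φ (χ g * t) (g • x) = g • φ t x`, since rescaling time by
`χ g` compensates for `g_* ξ = χ g • ξ`. Moving `g` through the composed flows one factor at a time
makes the spray equivariant. On the fibre over `x`, the spray restricted to the `i`-th axis is the
`i`-th flow, so its differential at `0` sends the `i`-th basis vector to `ξ i x`. These vectors span
the tangent space because the `ξ i` generate a module whose values fill it.

The analytic work is `IsFlowOf.contMDiff`. Flowing for complex time `t` is solving `c' = t • f c` on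
the real interval `[0, 1]`. In integral form this is an analytic equation in the Banach space `C([0,
1], E)`, solved near `t = 0` by the implicit function theorem (`exists_analytic_solution`). The
group law then propagates holomorphy to all times. -/

open Filter Set Topology

/-! ### Analyticity of composition operators on spaces of continuous functions -/

section Superposition

variable {E : Type*} [NormedAddCommGroup E] [NormedSpace ℂ E]
  {K : Type*} [TopologicalSpace K] [CompactSpace K]

/-- The pointwise action of a continuous multilinear map on continuous functions. -/
noncomputable def pointwiseMultilinear (K : Type*) [TopologicalSpace K] [CompactSpace K] {n : ℕ}
    (p : ContinuousMultilinearMap ℂ (fun _ : Fin n => E) E) :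
    ContinuousMultilinearMap ℂ (fun _ : Fin n => C(K, E)) C(K, E) :=
  MultilinearMap.mkContinuous
    { toFun := fun v =>
        ⟨fun s => p (fun i => v i s), p.cont.comp (continuous_pi fun i => (v i).continuous)⟩
      map_update_add' := by
        intro _ m i x y
        ext s
        have h (z : C(K, E)) : (fun j => Function.update m i z j s) =
            Function.update (fun j => m j s) i (z s) := by
          ext j
          by_cases hj : j = i
          · subst hj; simp
          · simp [hj]
        simp [h]
      map_update_smul' := by
        intro _ m i c x
        ext s
        have h (z : C(K, E)) : (fun j => Function.update m i z j s) =
            Function.update (fun j => m j s) i (z s) := by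
          ext j
          by_cases hj : j = i
          · subst hj; simp
          · simp [hj]
        simp [h] } ‖p‖ (by
      intro m
      refine (ContinuousMap.norm_le _ (by positivity)).2 fun s => (p.le_opNorm _).trans ?_
      gcongr with i
      exact (m i).norm_coe_le_norm s)

lemma norm_pointwiseMultilinear_le {n : ℕ}
    (p : ContinuousMultilinearMap ℂ (fun _ : Fin n => E) E) : ‖pointwiseMultilinear K p‖ ≤ ‖p‖ :=
  MultilinearMap.mkContinuous_norm_le _ (norm_nonneg _) _

/-- The superposition operator `z ↦ f ∘ z` on continuous functions is analytic at constants
at whose value `f` is analytic. -/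
theorem exists_analyticAt_superposition [CompleteSpace E] {f : E → E} {x₀ : E}
    (hf : AnalyticAt ℂ f x₀) :
    ∃ N : C(K, E) → C(K, E), AnalyticAt ℂ N (.const K x₀) ∧
      ∀ᶠ z in 𝓝 (ContinuousMap.const K x₀), ∀ s, N z s = f (z s) := by
  obtain ⟨p, r, hp⟩ := hf
  let q : FormalMultilinearSeries ℂ C(K, E) C(K, E) := fun n => pointwiseMultilinear K (p n)
  -- The norm bound on each coefficient carries the radius of convergence over to the series on
  -- `C(K, E)`; evaluating that series at `s` returns the series `p` at `z s`.
  have hq : p.radius ≤ q.radius :=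
    FormalMultilinearSeries.radius_le_of_le fun n => norm_pointwiseMultilinear_le _
  have hq0 : 0 < q.radius := (hp.r_pos.trans_le hp.r_le).trans_le hq
  have hball := q.hasFPowerSeriesOnBall hq0
  have hb : HasFPowerSeriesOnBall (fun z => q.sum (z - .const K x₀)) q (.const K x₀) q.radius := by
    simpa using hball.comp_sub (.const K x₀)
  refine ⟨fun z => q.sum (z - .const K x₀), ⟨q, q.radius, hb⟩, ?_⟩
  filter_upwards [Metric.eball_mem_nhds (ContinuousMap.const K x₀) hp.r_pos] with z hz s
  have h1 := hb.hasSum_sub (y := z)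
    (Metric.eball_subset_eball (hp.r_le.trans hq) hz)
  have h2 := ContinuousMap.hasSum_apply h1 s
  have h3 : z s ∈ Metric.eball x₀ r := by
    refine lt_of_le_of_lt ?_ (Metric.mem_eball.1 hz)
    rw [edist_dist, edist_dist]
    exact ENNReal.ofReal_le_ofReal (ContinuousMap.dist_apply_le_dist (f := z)
      (g := ContinuousMap.const K x₀) s)
  exact h2.unique (hp.hasSum_sub h3)

end Superposition

/-! ### Analytic dependence of solutions on parameters -/

section Volterra

variable {E : Type*} [NormedAddCommGroup E] [NormedSpace ℂ E]

/-- The primitive vanishing at `0` of the extension by constants of a continuous function on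
`[0, 1]`. -/
noncomputable def primitiveExtend (z : C(unitInterval, E)) (s : ℝ) : E :=
  ∫ r in (0 : ℝ)..s, z (projIcc 0 1 zero_le_one r)

lemma continuous_comp_projIcc {E : Type*} [TopologicalSpace E] (z : C(unitInterval, E)) :
    Continuous fun r : ℝ => z (projIcc 0 1 zero_le_one r) :=
  z.continuous.comp continuous_projIcc

lemma hasDerivAt_primitiveExtend [CompleteSpace E] (z : C(unitInterval, E)) (s : ℝ) :
    HasDerivAt (primitiveExtend z) (z (projIcc 0 1 zero_le_one s)) s :=
  intervalIntegral.integral_hasDerivAt_right ((continuous_comp_projIcc z).intervalIntegrable _ _)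
    ((continuous_comp_projIcc z).stronglyMeasurableAtFilter _ _)
    (continuous_comp_projIcc z).continuousAt

lemma primitiveExtend_zero (z : C(unitInterval, E)) : primitiveExtend z 0 = 0 := by
  simp [primitiveExtend]

/-- The Volterra operator `z ↦ ∫₀ˢ z` on continuous functions on `[0, 1]`. -/
noncomputable def volterra (E : Type*) [NormedAddCommGroup E] [NormedSpace ℂ E]
    [CompleteSpace E] : C(unitInterval, E) →L[ℂ] C(unitInterval, E) :=
  LinearMap.mkContinuous
    { toFun := fun z => ⟨fun s => primitiveExtend z s,
        (continuous_iff_continuousAt.2 fun s =>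
          (hasDerivAt_primitiveExtend z s).continuousAt).comp continuous_subtype_val⟩
      map_add' := fun x y => by
        ext s
        exact intervalIntegral.integral_add ((continuous_comp_projIcc x).intervalIntegrable _ _)
          ((continuous_comp_projIcc y).intervalIntegrable _ _)
      map_smul' := fun c x => by
        ext s
        exact intervalIntegral.integral_smul c _ } 1 (by
      intro z
      refine (ContinuousMap.norm_le _ (by positivity)).2 fun s => ?_
      refine (intervalIntegral.norm_integral_le_of_norm_le_const (C := ‖z‖)
        fun r _ => z.norm_coe_le_norm _).trans ?_
      rw [sub_zero, abs_of_nonneg s.2.1, one_mul]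
      exact mul_le_of_le_one_right (norm_nonneg _) s.2.2)

lemma volterra_apply [CompleteSpace E] (z : C(unitInterval, E)) (s : unitInterval) :
    volterra E z s = primitiveExtend z s := rfl

/-- Analytic dependence of solutions of an analytic differential equation on the initial value
and on a complex factor `t` of the right hand side: the equation is `c' = t • f c` on `[0, 1]`,
with `c 0 = x`, and `p = (t, x)` is close to `(0, x₀)`. -/
theorem exists_analytic_solution [CompleteSpace E] {f : E → E} {x₀ : E} (hf : AnalyticAt ℂ f x₀)
    {U : Set E} (hU : U ∈ 𝓝 x₀) :
    ∃ c : ℂ × E → ℝ → E, ContDiffAt ℂ ω (fun p => c p 1) (0, x₀) ∧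
      ∀ᶠ p in 𝓝 ((0 : ℂ), x₀), c p 0 = p.2 ∧ ∀ s ∈ Icc (0 : ℝ) 1,
        c p s ∈ U ∧ HasDerivAt (c p) (p.1 • f (c p s)) s := by
  obtain ⟨N, hN, hNf⟩ := exists_analyticAt_superposition (K := unitInterval) hf
  let κ : E →L[ℂ] C(unitInterval, E) := ContinuousLinearMap.const ℂ unitInterval
  have hκ (x : E) : κ x = .const _ x := rfl
  -- Near the base point, zeros of `Φ` are the solutions of `z = x + t ∫ f(z)`. At `t = 0` the
  -- integral term vanishes, so the partial derivative in `z` is the identity.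
  let Φ : (ℂ × E) × C(unitInterval, E) → C(unitInterval, E) :=
    fun u => u.2 - κ u.1.2 - u.1.1 • volterra E (N u.2)
  let u₀ : (ℂ × E) × C(unitInterval, E) := ((0, x₀), κ x₀)
  have hN' : ContDiffAt ℂ ω (fun u : (ℂ × E) × C(unitInterval, E) => N u.2) u₀ :=
    ContDiffAt.comp (g := N) u₀ hN.contDiffAt contDiffAt_snd
  have hΦ : ContDiffAt ℂ ω Φ u₀ := by
    have h1 : ContDiffAt ℂ ω
        (fun u : (ℂ × E) × C(unitInterval, E) => volterra E (N u.2)) u₀ :=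
      (volterra E).contDiff.contDiffAt.comp u₀ hN'
    have h2 : ContDiffAt ℂ ω (fun u : (ℂ × E) × C(unitInterval, E) => κ u.1.2) u₀ :=
      κ.contDiff.contDiffAt.comp u₀ (by fun_prop)
    have h3 : ContDiffAt ℂ ω (fun u : (ℂ × E) × C(unitInterval, E) => u.1.1) u₀ := by fun_prop
    exact (contDiffAt_snd.sub h2).sub (h3.smul h1)
  have hΦ0 : Φ u₀ = 0 := by simp [Φ, u₀]
  have hder : fderiv ℂ Φ u₀ ∘L .inr ℂ (ℂ × E) C(unitInterval, E) =
      ContinuousLinearMap.id ℂ C(unitInterval, E) := by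
    have h1 : HasFDerivAt (fun z : C(unitInterval, E) => ((0, x₀), z))
        (ContinuousLinearMap.inr ℂ (ℂ × E) C(unitInterval, E)) (κ x₀) :=
      hasFDerivAt_prodMk_right _ _
    have h2 := (hΦ.differentiableAt (by simp)).hasFDerivAt.comp (κ x₀) h1
    have h3 : Φ ∘ (fun z : C(unitInterval, E) => ((0, x₀), z)) = fun z => z - κ x₀ := by
      ext z; simp [Φ]
    rw [h3] at h2
    exact h2.unique ((hasFDerivAt_id _).sub_const _)
  have hinv : (fderiv ℂ Φ u₀ ∘L .inr ℂ (ℂ × E) C(unitInterval, E)).IsInvertible :=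
    ⟨.refl ℂ _, by rw [hder]; rfl⟩
  let ψ := hΦ.implicitFunction (by simp) hinv
  have hψ : ContDiffAt ℂ ω ψ (0, x₀) := hΦ.contDiffAt_implicitFunction (by simp) hinv
  have hψ0 : ψ (0, x₀) = κ x₀ := hΦ.implicitFunction_apply_self (by simp) hinv
  have hψe : ∀ᶠ p in 𝓝 ((0 : ℂ), x₀), Φ (p, ψ p) = 0 := by
    simpa [hΦ0] using hΦ.eventually_apply_implicitFunction (by simp) hinv
  have hUe : ∀ᶠ z in 𝓝 (κ x₀), ∀ s, z s ∈ U := by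
    obtain ⟨ε, hε, h⟩ := Metric.mem_nhds_iff.1 hU
    filter_upwards [Metric.ball_mem_nhds (κ x₀) hε] with z hz s
    exact h (lt_of_le_of_lt (ContinuousMap.dist_apply_le_dist (g := κ x₀) s) hz)
  have hψt : Tendsto ψ (𝓝 (0, x₀)) (𝓝 (κ x₀)) := hψ0 ▸ hψ.continuousAt
  have hfix : ∀ᶠ p in 𝓝 ((0 : ℂ), x₀), ∀ s : unitInterval,
      ψ p s = p.2 + p.1 • primitiveExtend (N (ψ p)) s := by
    filter_upwards [hψe] with p hp s
    have := congrArg (fun z => z s) hp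
    simp only [Φ, ContinuousMap.sub_apply, ContinuousMap.smul_apply, volterra_apply, hκ,
      ContinuousMap.const_apply, ContinuousMap.zero_apply] at this
    rw [sub_sub, sub_eq_zero] at this
    exact this
  -- `ψ p` lives only on `[0, 1]`; the integral formula extends it to all real `s`, which yields
  -- two-sided derivatives at the endpoints too.
  refine ⟨fun p s => p.2 + p.1 • primitiveExtend (N (ψ p)) s, ?_, ?_⟩
  · have h1 : ContDiffAt ℂ ω
        ((ContinuousMap.evalCLM ℂ (1 : unitInterval) : C(unitInterval, E) →L[ℂ] E) ∘ ψ) (0, x₀) :=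
      (ContinuousLinearMap.contDiff _).contDiffAt.comp _ hψ
    refine h1.congr_of_eventuallyEq ?_
    filter_upwards [hfix] with p hp
    exact (hp 1).symm
  · filter_upwards [hfix, hψt.eventually hUe, hψt.eventually hNf] with p hp hpU hpN
    refine ⟨by simp [primitiveExtend_zero], fun s hs => ?_⟩
    have hs' := hp ⟨s, hs⟩
    simp only at hs'
    rw [← hs']
    refine ⟨hpU _, ?_⟩
    have := ((hasDerivAt_primitiveExtend (N (ψ p)) s).const_smul p.1).const_add p.2
    rwa [projIcc_of_mem _ hs, hpN] at this

end Volterra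

/-! ### Integral curves in charts and their uniqueness -/

section IntegralCurves

variable {E : Type*} [NormedAddCommGroup E] [NormedSpace ℂ E]
  {X : Type*} [TopologicalSpace X] [ChartedSpace E X] [IsManifold 𝓘(ℂ, E) ω X]

/-- The expression of a vector field in the preferred chart at `p`. -/
noncomputable def chartField (ξ : HolVectorField E X) (p : X) (u : E) : E :=
  mfderiv 𝓘(ℂ, E) 𝓘(ℂ, E) (extChartAt 𝓘(ℂ, E) p) ((extChartAt 𝓘(ℂ, E) p).symm u)
    (ξ ((extChartAt 𝓘(ℂ, E) p).symm u))

lemma chartField_extChartAt (ξ : HolVectorField E X) {p x : X}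
    (hx : x ∈ (extChartAt 𝓘(ℂ, E) p).source) :
    chartField ξ p (extChartAt 𝓘(ℂ, E) p x) =
      mfderiv 𝓘(ℂ, E) 𝓘(ℂ, E) (extChartAt 𝓘(ℂ, E) p) x (ξ x) := by
  rw [chartField, (extChartAt 𝓘(ℂ, E) p).left_inv hx]

lemma contDiffAt_chartField (ξ : HolVectorField E X) {p : X} {u : E}
    (hu : u ∈ (extChartAt 𝓘(ℂ, E) p).target) : ContDiffAt ℂ ω (chartField ξ p) u := by
  -- The tangent bundle loses one degree of smoothness, but `ω + 1` is `ω`.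
  have : IsManifold 𝓘(ℂ, E) (ω + 1) X := ‹IsManifold 𝓘(ℂ, E) ω X›
  have : IsManifold 𝓘(ℂ, E) 1 X := IsManifold.of_le (n := ω) le_top
  have hx := (extChartAt 𝓘(ℂ, E) p).map_target hu
  have htarget : (extChartAt 𝓘(ℂ, E) p).target ∈ 𝓝 u := (isOpen_extChartAt_target p).mem_nhds hu
  have h1 : ContMDiffAt 𝓘(ℂ, E) 𝓘(ℂ, E) ω (fun x =>
      (trivializationAt E (TangentSpace 𝓘(ℂ, E)) p ⟨x, ξ x⟩).2)
      ((extChartAt 𝓘(ℂ, E) p).symm u) :=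
    (Bundle.Trivialization.contMDiffAt_section_iff (IB := 𝓘(ℂ, E)) (n := ω)
      (trivializationAt E (TangentSpace 𝓘(ℂ, E)) p)
      (by simpa using hx)).1 (ξ.contMDiff _)
  have h2 : ContMDiffAt 𝓘(ℂ, E) 𝓘(ℂ, E) ω (extChartAt 𝓘(ℂ, E) p).symm u :=
    (contMDiffOn_extChartAt_symm p).contMDiffAt htarget
  refine ((h1.comp u h2).contDiffAt).congr_of_eventuallyEq ?_
  filter_upwards [htarget] with v hv
  have hv' := (extChartAt 𝓘(ℂ, E) p).map_target hv
  rw [extChartAt_source] at hv'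
  rw [chartField, ← TangentBundle.continuousLinearMapAt_trivializationAt hv']
  exact Bundle.Trivialization.continuousLinearMapAt_apply_of_mem
    (trivializationAt E (TangentSpace 𝓘(ℂ, E)) p) (R := ℂ) (by simpa using hv') _

/-- The curve `γ`, with real time, satisfies `γ' = t • ξ γ` at time `s`. -/
structure IsIntegralCurveAlong (ξ : HolVectorField E X) (t : ℂ) (γ : ℝ → X) (s : ℝ) : Prop where
  continuousAt : ContinuousAt γ s
  hasDerivAt : ∀ p, γ s ∈ (extChartAt 𝓘(ℂ, E) p).source →
    HasDerivAt (fun r => extChartAt 𝓘(ℂ, E) p (γ r))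
      (t • chartField ξ p (extChartAt 𝓘(ℂ, E) p (γ s))) s

/-- Restriction to the real line through `0` and `t` reduces complex time to a real differential
equation, with `t` appearing as a factor by the chain rule. -/
lemma IsEntireIntegralCurve.along {ξ : HolVectorField E X} {γ : ℂ → X}
    (hγ : IsEntireIntegralCurve ξ γ) (t : ℂ) (s : ℝ) :
    IsIntegralCurveAlong ξ t (fun r : ℝ => γ (r * t)) s := by
  have : IsManifold 𝓘(ℂ, E) 1 X := IsManifold.of_le (n := ω) le_top
  refine ⟨(hγ _).continuousAt.comp' (f := fun r : ℝ => (r : ℂ) * t) (by fun_prop),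
    fun p hp => ?_⟩
  have h1 := (mdifferentiableAt_extChartAt (I := 𝓘(ℂ, E)) (x := p)
    (by simpa using hp)).hasMFDerivAt.comp _ (hγ (s * t))
  have h2 : HasDerivAt (fun z => extChartAt 𝓘(ℂ, E) p (γ z))
      (chartField ξ p (extChartAt 𝓘(ℂ, E) p (γ (s * t)))) ((s : ℂ) * t) := by
    rw [chartField_extChartAt ξ hp]
    let D : E →L[ℂ] E := mfderiv 𝓘(ℂ, E) 𝓘(ℂ, E) (extChartAt 𝓘(ℂ, E) p) (γ (s * t))
    let v : E := ξ (γ (s * t))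
    have h : HasFDerivAt (fun z => extChartAt 𝓘(ℂ, E) p (γ z))
        (D.comp ((1 : ℂ →L[ℂ] ℂ).smulRight v)) ((s : ℂ) * t) := hasMFDerivAt_iff_hasFDerivAt.1 h1
    refine h.hasDerivAt.congr_deriv ?_
    change D (((1 : ℂ →L[ℂ] ℂ) 1) • v) = D v
    rw [one_apply_eq_self, one_smul]
  have h3 : HasDerivAt (fun r : ℝ => (r : ℂ) * t) t s := by
    simpa using (Complex.ofRealCLM.hasDerivAt (x := s)).mul_const t
  exact h2.scomp s h3

lemma isIntegralCurveAlong_extChartAt_symm {ξ : HolVectorField E X} {t : ℂ} {c : ℝ → E} {s : ℝ}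
    {p : X} (hs : c s ∈ (extChartAt 𝓘(ℂ, E) p).target)
    (hc : HasDerivAt c (t • chartField ξ p (c s)) s) :
    IsIntegralCurveAlong ξ t (fun r => (extChartAt 𝓘(ℂ, E) p).symm (c r)) s := by
  have : IsManifold 𝓘(ℂ, E) 1 X := IsManifold.of_le (n := ω) le_top
  refine ⟨(continuousAt_extChartAt_symm'' hs).comp' hc.continuousAt, fun q hq => ?_⟩
  have h0 := mdifferentiableWithinAt_extChartAt_symm hs
  have hinv := mfderivWithin_extChartAt_symm_comp_mfderiv_extChartAt hs
  simp only [ModelWithCorners.range_eq_univ, mdifferentiableWithinAt_univ, mfderivWithin_univ]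
    at h0 hinv
  have h1 := (mdifferentiableAt_extChartAt (I := 𝓘(ℂ, E)) (x := q)
    (by simpa using hq)).hasMFDerivAt.comp _ h0.hasMFDerivAt
  let D : E →L[ℂ] E := mfderiv 𝓘(ℂ, E) 𝓘(ℂ, E) (extChartAt 𝓘(ℂ, E) q)
    ((extChartAt 𝓘(ℂ, E) p).symm (c s))
  let D' : E →L[ℂ] E := mfderiv 𝓘(ℂ, E) 𝓘(ℂ, E) (extChartAt 𝓘(ℂ, E) p).symm (c s)
  have h2 : HasFDerivAt (fun z => extChartAt 𝓘(ℂ, E) q ((extChartAt 𝓘(ℂ, E) p).symm z))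
    (D.comp D') (c s) := hasMFDerivAt_iff_hasFDerivAt.1 h1
  refine ((h2.restrictScalars ℝ).comp_hasDerivAt s hc).congr_deriv ?_
  rw [chartField_extChartAt ξ hq]
  have h3 : D' (chartField ξ p (c s)) = (ξ ((extChartAt 𝓘(ℂ, E) p).symm (c s)) : E) :=
    DFunLike.congr_fun hinv (ξ ((extChartAt 𝓘(ℂ, E) p).symm (c s)))
  change D (D' (t • chartField ξ p (c s))) = t • D (ξ ((extChartAt 𝓘(ℂ, E) p).symm (c s)) : E)
  rw [map_smul, map_smul, h3]

/-- In the chart at the common starting point the field is `C^1`, hence locally Lipschitz, and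
uniqueness for ordinary differential equations applies. -/
lemma IsIntegralCurveAlong.eventually_eq {ξ : HolVectorField E X} {t : ℂ}
    {γ₁ γ₂ : ℝ → X} {a b : ℝ} (hab : a < b)
    (h₁ : ∀ s ∈ Icc a b, IsIntegralCurveAlong ξ t γ₁ s)
    (h₂ : ∀ s ∈ Icc a b, IsIntegralCurveAlong ξ t γ₂ s)
    (h : γ₁ a = γ₂ a) : ∀ᶠ s in 𝓝[>] a, γ₁ s = γ₂ s := by
  set p := γ₁ a with hp
  have hpp := mem_extChartAt_source (I := 𝓘(ℂ, E)) p
  have hsrc := extChartAt_source_mem_nhds (I := 𝓘(ℂ, E)) p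
  have ha : a ∈ Icc a b := left_mem_Icc.2 hab.le
  obtain ⟨K, u, hu, hK⟩ := ((contDiffAt_chartField ξ (mem_extChartAt_target p)).of_le
    (le_top : (1 : WithTop ℕ∞) ≤ ω)).exists_lipschitzOnWith
  have key (γ : ℝ → X) (hγ : IsIntegralCurveAlong ξ t γ a) (hγp : γ a = p) :
      ∀ᶠ s in 𝓝 a, γ s ∈ (extChartAt 𝓘(ℂ, E) p).source ∧ extChartAt 𝓘(ℂ, E) p (γ s) ∈ u := by
    refine (hγ.continuousAt.eventually (hγp ▸ hsrc)).and ?_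
    exact (hγ.hasDerivAt p (hγp ▸ hpp)).continuousAt.eventually 
      (by simp only [hγp]; exact hu)
  obtain ⟨ε, hε, hball⟩ := Metric.eventually_nhds_iff.1
    ((key γ₁ (h₁ a ha) rfl).and (key γ₂ (h₂ a ha) h.symm))
  -- Half of `ε` keeps the closed interval `[a, a + δ]` inside the open ball where both curves stay
  -- in the chart and in the Lipschitz set.
  set δ := min (b - a) (ε / 2) with hδ
  have hδ0 : 0 < δ := lt_min (sub_pos.2 hab) (half_pos hε)
  have hin : ∀ s ∈ Icc a (a + δ), s ∈ Icc a b ∧ dist s a < ε := by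
    intro s hs
    have h1 : δ ≤ b - a := min_le_left _ _
    have h2 : δ ≤ ε / 2 := min_le_right _ _
    refine ⟨⟨hs.1, by linarith [hs.2]⟩, ?_⟩
    rw [Real.dist_eq, abs_of_nonneg (sub_nonneg.2 hs.1)]
    linarith [hs.2]
  have hlip : LipschitzOnWith (‖t‖₊ * K) (fun v => t • chartField ξ p v) u := by
    refine LipschitzOnWith.of_dist_le_mul fun x hx y hy => ?_
    rw [dist_smul₀, NNReal.coe_mul, coe_nnnorm, mul_assoc]
    exact mul_le_mul_of_nonneg_left (hK.dist_le_mul x hx y hy) (norm_nonneg _)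
  have d₁ : ∀ s ∈ Icc a (a + δ), HasDerivAt (fun r => extChartAt 𝓘(ℂ, E) p (γ₁ r))
      (t • chartField ξ p (extChartAt 𝓘(ℂ, E) p (γ₁ s))) s := fun s hs =>
    (h₁ s (hin s hs).1).hasDerivAt p (hball (hin s hs).2).1.1
  have d₂ : ∀ s ∈ Icc a (a + δ), HasDerivAt (fun r => extChartAt 𝓘(ℂ, E) p (γ₂ r))
      (t • chartField ξ p (extChartAt 𝓘(ℂ, E) p (γ₂ s))) s := fun s hs =>
    (h₂ s (hin s hs).1).hasDerivAt p (hball (hin s hs).2).2.1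
  have heq := ODE_solution_unique_of_mem_Icc_right (a := a) (b := a + δ)
    (v := fun _ v => t • chartField ξ p v) (s := fun _ => u) (K := ‖t‖₊ * K)
    (f := fun r => extChartAt 𝓘(ℂ, E) p (γ₁ r)) (g := fun r => extChartAt 𝓘(ℂ, E) p (γ₂ r))
    (fun _ _ => hlip)
    (fun s hs => (d₁ s hs).continuousAt.continuousWithinAt)
    (fun s hs => (d₁ s (Ico_subset_Icc_self hs)).hasDerivWithinAt)
    (fun s hs => (hball (hin s (Ico_subset_Icc_self hs)).2).1.2)
    (fun s hs => (d₂ s hs).continuousAt.continuousWithinAt)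
    (fun s hs => (d₂ s (Ico_subset_Icc_self hs)).hasDerivWithinAt)
    (fun s hs => (hball (hin s (Ico_subset_Icc_self hs)).2).2.2)
    (by simp only [← hp, h])
  filter_upwards [Ioo_mem_nhdsGT (show a < a + δ by linarith)] with s hs
  have hs' := Ioo_subset_Icc_self hs
  exact (extChartAt 𝓘(ℂ, E) p).injOn (hball (hin s hs').2).1.1 (hball (hin s hs').2).2.1 (heq hs')

/-- Continuous induction: the coincidence set is closed because `X` is Hausdorff, and local
uniqueness extends it to the right of each of its points. -/
theorem IsIntegralCurveAlong.eqOn [T2Space X] {ξ : HolVectorField E X} {t : ℂ}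
    {γ₁ γ₂ : ℝ → X} {a b : ℝ}
    (h₁ : ∀ s ∈ Icc a b, IsIntegralCurveAlong ξ t γ₁ s)
    (h₂ : ∀ s ∈ Icc a b, IsIntegralCurveAlong ξ t γ₂ s)
    (h : γ₁ a = γ₂ a) : EqOn γ₁ γ₂ (Icc a b) := by
  refine IsClosed.Icc_subset_of_forall_mem_nhdsWithin (s := {s | γ₁ s = γ₂ s}) ?_ h ?_
  · have c₁ : ContinuousOn γ₁ (Icc a b) := fun s hs => (h₁ s hs).continuousAt.continuousWithinAt
    have c₂ : ContinuousOn γ₂ (Icc a b) := fun s hs => (h₂ s hs).continuousAt.continuousWithinAt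
    have := (c₁.prodMk c₂).preimage_isClosed_of_isClosed isClosed_Icc isClosed_diagonal
    rwa [inter_comm] at this
  · rintro s ⟨hs, hsI⟩
    exact IsIntegralCurveAlong.eventually_eq hsI.2
      (fun r hr => h₁ r ⟨hsI.1.trans hr.1, hr.2⟩) (fun r hr => h₂ r ⟨hsI.1.trans hr.1, hr.2⟩) hs

theorem IsEntireIntegralCurve.eq [T2Space X] {ξ : HolVectorField E X} {γ₁ γ₂ : ℂ → X}
    (h₁ : IsEntireIntegralCurve ξ γ₁) (h₂ : IsEntireIntegralCurve ξ γ₂) (h : γ₁ 0 = γ₂ 0) :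
    γ₁ = γ₂ := by
  ext t
  simpa using IsIntegralCurveAlong.eqOn (a := 0) (b := 1) (fun s _ => h₁.along t s)
    (fun s _ => h₂.along t s) (by simpa using h) (right_mem_Icc.2 zero_le_one)

end IntegralCurves

/-! ### Group law, holomorphy and equivariance of flows -/

section Flows

variable {E : Type*} [NormedAddCommGroup E] [NormedSpace ℂ E]
  {X : Type*} [TopologicalSpace X] [ChartedSpace E X] [IsManifold 𝓘(ℂ, E) ω X]

lemma IsEntireIntegralCurve.hasMFDerivAt_comp {ξ : HolVectorField E X} {γ : ℂ → X}
    (hγ : IsEntireIntegralCurve ξ γ) {f : ℂ → ℂ} {a t : ℂ} (hf : HasDerivAt f a t) :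
    HasMFDerivAt 𝓘(ℂ) 𝓘(ℂ, E) (fun s => γ (f s)) t
      ((1 : ℂ →L[ℂ] ℂ).smulRight (a • ξ (γ (f t)))) := by
  have h1 := (hγ (f t)).comp t (hasMFDerivAt_iff_hasFDerivAt.2 hf.hasFDerivAt)
  refine h1.congr_mfderiv ?_
  let v : E := ξ (γ (f t))
  change ((1 : ℂ →L[ℂ] ℂ).smulRight v).comp (ContinuousLinearMap.toSpanSingleton ℂ a) =
    (1 : ℂ →L[ℂ] ℂ).smulRight (a • v)
  ext
  simp

lemma IsEntireIntegralCurve.comp_add_const {ξ : HolVectorField E X} {γ : ℂ → X}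
    (hγ : IsEntireIntegralCurve ξ γ) (b : ℂ) : IsEntireIntegralCurve ξ fun s => γ (s + b) := by
  intro t
  simpa using hγ.hasMFDerivAt_comp ((hasDerivAt_id t).add_const b)

/-- As functions of `s`, both sides are integral curves starting at `φ t x`. -/
lemma IsFlowOf.add [T2Space X] {ξ : HolVectorField E X} {φ : ℂ → X → X} (hφ : IsFlowOf ξ φ)
    (s t : ℂ) (x : X) : φ (s + t) x = φ s (φ t x) := by
  refine congrFun (IsEntireIntegralCurve.eq ((hφ x).2.comp_add_const t) (hφ (φ t x)).2 ?_) s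
  simp [(hφ (φ t x)).1]

lemma IsFlowOf.contMDiffAt_zero [CompleteSpace E] [T2Space X] {ξ : HolVectorField E X}
    {φ : ℂ → X → X} (hφ : IsFlowOf ξ φ) (p : X) :
    ContMDiffAt (𝓘(ℂ).prod 𝓘(ℂ, E)) 𝓘(ℂ, E) ω (fun q : ℂ × X => φ q.1 q.2) (0, p) := by
  obtain ⟨c, hc, hce⟩ := exists_analytic_solution
    (contDiffAt_chartField ξ (mem_extChartAt_target p)).analyticAt
    (extChartAt_target_mem_nhds (I := 𝓘(ℂ, E)) p)
  have hpair : ContMDiffAt (𝓘(ℂ).prod 𝓘(ℂ, E)) 𝓘(ℂ, ℂ × E) ω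
      (fun q : ℂ × X => (q.1, extChartAt 𝓘(ℂ, E) p q.2)) (0, p) :=
    contMDiffAt_fst.prodMk_space (contMDiffAt_extChartAt.comp (0, p) contMDiffAt_snd)
  -- Uniqueness on `[0, 1]` identifies the flow with the analytic solution in the chart, evaluated
  -- at time `1`.
  have heq : (fun q : ℂ × X => φ q.1 q.2) =ᶠ[𝓝 (0, p)] fun q =>
      (extChartAt 𝓘(ℂ, E) p).symm (c (q.1, extChartAt 𝓘(ℂ, E) p q.2) 1) := by
    have hsrc : ∀ᶠ q : ℂ × X in 𝓝 (0, p), q.2 ∈ (extChartAt 𝓘(ℂ, E) p).source :=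
      continuousAt_snd.eventually (extChartAt_source_mem_nhds (I := 𝓘(ℂ, E)) p)
    filter_upwards [hpair.continuousAt.eventually hce, hsrc] with q hq hqs
    have := IsIntegralCurveAlong.eqOn (a := 0) (b := 1)
      (fun s _ => (hφ q.2).2.along q.1 s)
      (fun s hs => isIntegralCurveAlong_extChartAt_symm (hq.2 s hs).1 (hq.2 s hs).2)
      (by simp [(hφ q.2).1, hq.1, -extChartAt, (extChartAt 𝓘(ℂ, E) p).left_inv hqs])
      (right_mem_Icc.2 zero_le_one)
    simpa using this
  have hc0 : c (0, extChartAt 𝓘(ℂ, E) p p) 1 = extChartAt 𝓘(ℂ, E) p p := by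
    have h1 := heq.self_of_nhds
    have h2 := (hce.self_of_nhds.2 1 (right_mem_Icc.2 zero_le_one)).1
    simp only [(hφ p).1] at h1
    exact ((extChartAt 𝓘(ℂ, E) p).right_inv h2).symm.trans
      (congrArg (extChartAt 𝓘(ℂ, E) p) h1.symm)
  have hsymm : ContMDiffAt 𝓘(ℂ, E) 𝓘(ℂ, E) ω (extChartAt 𝓘(ℂ, E) p).symm
      (c (0, extChartAt 𝓘(ℂ, E) p p) 1) := by
    rw [hc0]
    exact (contMDiffOn_extChartAt_symm p).contMDiffAt
      (extChartAt_target_mem_nhds (I := 𝓘(ℂ, E)) p)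
  have h1 : ContMDiffAt (𝓘(ℂ).prod 𝓘(ℂ, E)) 𝓘(ℂ, E) ω
      ((fun q : ℂ × E => c q 1) ∘ fun q : ℂ × X => (q.1, extChartAt 𝓘(ℂ, E) p q.2)) (0, p) :=
    ContMDiffAt.comp (0, p) hc.contMDiffAt hpair
  exact (ContMDiffAt.comp (0, p) hsymm h1).congr_of_eventuallyEq heq

/-- The flow of a complete holomorphic vector field is holomorphic. -/
theorem IsFlowOf.contMDiff [CompleteSpace E] [T2Space X] {ξ : HolVectorField E X}
    {φ : ℂ → X → X} (hφ : IsFlowOf ξ φ) :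
    ContMDiff (𝓘(ℂ).prod 𝓘(ℂ, E)) 𝓘(ℂ, E) ω (fun q : ℂ × X => φ q.1 q.2) := by
  rintro ⟨t₀, x⟩
  -- For fixed `x`, this set of good times contains `0` and is clopen in the connected plane.
  let S : Set ℂ := {t | ContMDiffAt (𝓘(ℂ).prod 𝓘(ℂ, E)) 𝓘(ℂ, E) ω
    (fun q : ℂ × X => φ q.1 q.2) (t, x)}
  have hcont : Continuous fun t => φ t x :=
    continuous_iff_continuousAt.2 fun t => ((hφ x).2 t).continuousAt
  have hopenNhds (p : ℂ × X) (hp : ContMDiffAt (𝓘(ℂ).prod 𝓘(ℂ, E)) 𝓘(ℂ, E) ω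
      (fun q : ℂ × X => φ q.1 q.2) p) : ∀ᶠ p' in 𝓝 p,
      ContMDiffAt (𝓘(ℂ).prod 𝓘(ℂ, E)) 𝓘(ℂ, E) ω (fun q : ℂ × X => φ q.1 q.2) p' :=
    (contMDiffAt_iff_contMDiffAt_nhds (by simp)).1 hp
  have hopen : IsOpen S := isOpen_iff_mem_nhds.2 fun t ht =>
    (Continuous.continuousAt (f := fun s : ℂ => (s, x)) (by fun_prop)).eventually
      (hopenNhds (t, x) ht)
  have hclosed : IsClosed S := by
    refine isClosed_of_closure_subset fun t ht => ?_
    have hpair : ContinuousAt (fun r : ℂ => (t - r, φ r x)) t :=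
      (continuous_const.sub continuous_id).continuousAt.prodMk hcont.continuousAt
    -- As `r` tends to `t`, the pair `(t - r, φ r x)` tends to `(0, φ t x)`, where the flow is
    -- holomorphic. A good time `r` close to `t` then makes `t` good through `φ^t = φ^(t - r) ∘
    -- φ^r`.
    have h0 := hpair.eventually (by simpa using hopenNhds _ (hφ.contMDiffAt_zero (φ t x)))
    obtain ⟨r, hr, hrS⟩ := mem_closure_iff_nhds.1 ht _ h0
    have h1 : ContMDiffAt (𝓘(ℂ).prod 𝓘(ℂ, E)) 𝓘(ℂ, E) ω (fun q : ℂ × X => φ r q.2) (t, x) :=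
      ContMDiffAt.comp (g := fun q : ℂ × X => φ q.1 q.2) (f := fun q : ℂ × X => (r, q.2))
        (t, x) hrS (contMDiffAt_const.prodMk contMDiffAt_snd)
    have hsub : ContMDiffAt (𝓘(ℂ).prod 𝓘(ℂ, E)) 𝓘(ℂ) ω (fun q : ℂ × X => q.1 - r) (t, x) :=
      ContMDiffAt.comp (g := fun z : ℂ => z - r) (t, x)
        (contDiff_id.sub contDiff_const).contDiffAt.contMDiffAt contMDiffAt_fst
    have h2 : ContMDiffAt (𝓘(ℂ).prod 𝓘(ℂ, E)) 𝓘(ℂ, E) ω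
        (fun q : ℂ × X => φ (q.1 - r) (φ r q.2)) (t, x) :=
      ContMDiffAt.comp (g := fun q : ℂ × X => φ q.1 q.2)
        (f := fun q : ℂ × X => (q.1 - r, φ r q.2)) (t, x) hr (hsub.prodMk h1)
    refine h2.congr_of_eventuallyEq (Eventually.of_forall fun q => ?_)
    simp only [← hφ.add, sub_add_cancel]
  have huniv : S = univ := IsClopen.eq_univ ⟨hclosed, hopen⟩ ⟨0, hφ.contMDiffAt_zero x⟩
  exact huniv.symm.subset (mem_univ t₀)

lemma IsFlowOf.smul [T2Space X] {ξ : HolVectorField E X} {φ : ℂ → X → X} (hφ : IsFlowOf ξ φ)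
    {G : Type*} [Group G] [MulAction G X] {χ : G →* ℂˣ} (hξ : TransformsBy χ ξ) {g : G}
    (hg : ContMDiff 𝓘(ℂ, E) 𝓘(ℂ, E) ω fun x : X => g • x) (t : ℂ) (x : X) :
    φ (χ g * t) (g • x) = g • φ t x := by
  -- The factor `(χ g)⁻¹` from the chain rule cancels the factor `χ g` by which the differential of
  -- `g` scales `ξ`.
  have hcurve : IsEntireIntegralCurve ξ fun s => g • φ ((χ g : ℂ)⁻¹ * s) x := by
    intro s
    set y := φ ((χ g : ℂ)⁻¹ * s) x
    have h1 := ((hg.mdifferentiable (by simp)) y).hasMFDerivAt.comp s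
      ((hφ x).2.hasMFDerivAt_comp ((hasDerivAt_id' s).const_mul (χ g : ℂ)⁻¹))
    refine h1.congr_mfderiv ?_
    let D : E →L[ℂ] E := mfderiv 𝓘(ℂ, E) 𝓘(ℂ, E) (fun z : X => g • z) y
    let v : E := ξ y
    let w : E := ξ (g • y)
    have hD : D v = (χ g : ℂ) • w := hξ g y
    change D.comp ((1 : ℂ →L[ℂ] ℂ).smulRight (((χ g : ℂ)⁻¹ * 1) • v)) = (1 : ℂ →L[ℂ] ℂ).smulRight w
    ext
    simp [hD]
  have := congrFun (IsEntireIntegralCurve.eq (hφ (g • x)).2 hcurve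
    (by simp [(hφ x).1, (hφ (g • x)).1])) (χ g * t)
  simpa using this

end Flows

/-! ### Compositions of flows -/

section ComposeFlows

lemma composeFlows_zero {X : Type*} (φ : Fin 0 → ℂ → X → X) (a : Fin 0 → ℂ) (x : X) :
    composeFlows φ a x = x := by
  simp [composeFlows]

lemma composeFlows_succ {X : Type*} {k : ℕ} (φ : Fin (k + 1) → ℂ → X → X) (a : Fin (k + 1) → ℂ)
    (x : X) : composeFlows φ a x =
      φ 0 (a 0) (composeFlows (fun i => φ i.succ) (fun i => a i.succ) x) := by
  simp [composeFlows, List.ofFn_succ]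

lemma composeFlows_eq_self {X : Type*} {k : ℕ} {φ : Fin k → ℂ → X → X}
    (hφ : ∀ i x, φ i 0 x = x) (x : X) : composeFlows φ 0 x = x := by
  induction k with
  | zero => exact composeFlows_zero _ _ _
  | succ k ih =>
    rw [composeFlows_succ, Pi.zero_apply, hφ]
    exact ih fun i => hφ i.succ

/-- All other factors are time-`0` maps. This allows the differential of the spray to be computed
axis by axis. -/
lemma composeFlows_single {X : Type*} {k : ℕ} {φ : Fin k → ℂ → X → X}
    (hφ : ∀ i x, φ i 0 x = x) (i : Fin k) (t : ℂ) (x : X) :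
    composeFlows φ (Pi.single i t) x = φ i t x := by
  induction k with
  | zero => exact i.elim0
  | succ k ih =>
    rw [composeFlows_succ]
    refine Fin.cases ?_ (fun j => ?_) i
    · have : (fun j : Fin k => (Pi.single 0 t : Fin (k + 1) → ℂ) j.succ) = 0 := by
        ext j; simp
      rw [this, composeFlows_eq_self fun i => hφ i.succ, Pi.single_eq_same]
    · have : (fun l : Fin k => (Pi.single j.succ t : Fin (k + 1) → ℂ) l.succ) = Pi.single j t := by
        ext l; simp [Pi.single_apply]
      rw [this, ih fun i => hφ i.succ, Pi.single_eq_of_ne (Fin.succ_ne_zero j).symm, hφ]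

lemma composeFlows_equivariant {G X : Type*} [SMul G X] {k : ℕ} {φ : Fin k → ℂ → X → X}
    {c : Fin k → ℂ} {g : G} (h : ∀ i t x, φ i (c i * t) (g • x) = g • φ i t x) (a : Fin k → ℂ)
    (x : X) : composeFlows φ (fun i => c i * a i) (g • x) = g • composeFlows φ a x := by
  induction k with
  | zero => simp [composeFlows_zero]
  | succ k ih =>
    rw [composeFlows_succ, composeFlows_succ, ih fun i => h i.succ, h]

variable {E : Type*} [NormedAddCommGroup E] [NormedSpace ℂ E]
  {X : Type*} [TopologicalSpace X] [ChartedSpace E X]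

/-- The parameter manifold `Y` is arbitrary so that the result covers both the total space of the
bundle and a single fibre. -/
lemma contMDiff_composeFlows {k : ℕ} {φ : Fin k → ℂ → X → X}
    (hφ : ∀ i, ContMDiff (𝓘(ℂ).prod 𝓘(ℂ, E)) 𝓘(ℂ, E) ω fun q : ℂ × X => φ i q.1 q.2)
    {Y : Type*} [TopologicalSpace Y] {F H : Type*} [NormedAddCommGroup F] [NormedSpace ℂ F]
    [TopologicalSpace H] [ChartedSpace H Y] {I : ModelWithCorners ℂ F H} {a : Y → Fin k → ℂ}
    {b : Y → X} (ha : ContMDiff I 𝓘(ℂ, Fin k → ℂ) ω a) (hb : ContMDiff I 𝓘(ℂ, E) ω b) :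
    ContMDiff I 𝓘(ℂ, E) ω fun y => composeFlows φ (a y) (b y) := by
  induction k with
  | zero => simpa [composeFlows_zero] using hb
  | succ k ih =>
    simp only [composeFlows_succ]
    rw [contMDiff_pi_space] at ha
    exact (hφ 0).comp ((ha 0).prodMk
      (ih (fun i => hφ i.succ) (contMDiff_pi_space.2 fun i => ha i.succ)))

end ComposeFlows

/-! ### Holomorphic maps into and out of the trivial bundle -/

section TrivialBundle

variable {E : Type*} [NormedAddCommGroup E] [NormedSpace ℂ E]
  {X : Type*} [TopologicalSpace X] [ChartedSpace E X]
  {B : Type*} [NormedAddCommGroup B] [NormedSpace ℂ B]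

lemma contMDiff_trivial_iff {Y : Type*} [TopologicalSpace Y] {F H : Type*} [NormedAddCommGroup F]
    [NormedSpace ℂ F] [TopologicalSpace H] [ChartedSpace H Y] {I : ModelWithCorners ℂ F H}
    {f : Y → Bundle.TotalSpace B (Bundle.Trivial X B)} :
    ContMDiff I (𝓘(ℂ, E).prod 𝓘(ℂ, B)) ω f ↔
      ContMDiff I 𝓘(ℂ, E) ω (fun y => (f y).1) ∧ ContMDiff I 𝓘(ℂ, B) ω (fun y => ((f y).2 : B)) :=
  ⟨fun h => ⟨fun y => ((Bundle.contMDiffAt_totalSpace (IB := 𝓘(ℂ, E))).1 (h y)).1,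
    fun y => ((Bundle.contMDiffAt_totalSpace (IB := 𝓘(ℂ, E))).1 (h y)).2⟩,
    fun h y => (Bundle.contMDiffAt_totalSpace (IB := 𝓘(ℂ, E))).2 ⟨h.1 y, h.2 y⟩⟩

lemma contMDiff_trivial_snd :
    ContMDiff (𝓘(ℂ, E).prod 𝓘(ℂ, B)) 𝓘(ℂ, B) ω
      fun e : Bundle.TotalSpace B (Bundle.Trivial X B) => (e.2 : B) :=
  (contMDiff_trivial_iff.1 contMDiff_id).2

end TrivialBundle

/-! ### The flow spray is dominating and equivariant -/

section FlowSpray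

variable {E : Type*} [NormedAddCommGroup E] [NormedSpace ℂ E]
  {X : Type*} [TopologicalSpace X] [ChartedSpace E X]

lemma isLiftedAction_twistedAction {F : Type*} [NormedAddCommGroup F] [NormedSpace ℂ F]
    {G : Type*} [Group G] [TopologicalSpace G] [ChartedSpace F G]
    [MulAction G X] [ContMDiffSMul 𝓘(ℂ, F) 𝓘(ℂ, E) ω G X]
    {k : ℕ} {χ : Fin k → G →* ℂˣ} (hχ : ∀ i, IsHolCharacter (F := F) (χ i)) :
    IsLiftedAction (X := X) E F (twistedAction χ) where
  one_act e := (Bundle.TotalSpace.toProd X (Fin k → ℂ)).injective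
    (Prod.ext (one_smul G e.1) (funext fun i => by simp [twistedAction]))
  mul_act g h e := by simp [twistedAction, mul_smul, mul_assoc]
  linear g x := ⟨(LinearMap.pi fun i => (χ i g : ℂ) • LinearMap.proj i :
    (Fin k → ℂ) →ₗ[ℂ] (Fin k → ℂ)), fun v => rfl⟩
  holomorphic := by
    refine contMDiff_trivial_iff.2 ⟨?_, contMDiff_pi_space.2 fun i => ?_⟩
    · exact (contMDiff_smul (I := 𝓘(ℂ, F)) (I' := 𝓘(ℂ, E)) (n := ω) (G := G) (M := X)).comp
        (contMDiff_fst.prodMk ((Bundle.contMDiff_proj _).comp contMDiff_snd))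
    · exact ((hχ i).comp contMDiff_fst).mul
        (contMDiff_pi_space.1 (contMDiff_trivial_snd.comp contMDiff_snd) i)

variable [IsManifold 𝓘(ℂ, E) ω X]

theorem isDominatingSpray_flowSpray [CompleteSpace E] [T2Space X]
    (hX : FieldsSpanTangentSpaces E X) {k : ℕ} {ξ : Fin k → HolVectorField E X}
    (hgen : GenerateFields ξ) {φ : Fin k → ℂ → X → X} (hφ : ∀ i, IsFlowOf (ξ i) (φ i)) :
    IsDominatingSpray E (flowSpray φ) where
  holomorphic := contMDiff_composeFlows (fun i => (hφ i).contMDiff) contMDiff_trivial_snd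
    (Bundle.contMDiff_proj _)
  zero x := composeFlows_eq_self (fun i y => (hφ i y).1) x
  dominating x := by
    have hfun : (fun v : Fin k → ℂ => flowSpray φ (⟨x, (trivializationAt (Fin k → ℂ)
        (Bundle.Trivial X (Fin k → ℂ)) x).symmL ℂ x v⟩ :
          Bundle.TotalSpace (Fin k → ℂ) (Bundle.Trivial X (Fin k → ℂ)))) =
        fun v => composeFlows φ v x := by
      ext v
      simp [flowSpray]
    rw [hfun]
    have hsmooth : ContMDiff 𝓘(ℂ, Fin k → ℂ) 𝓘(ℂ, E) ω fun v => composeFlows φ v x :=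
      contMDiff_composeFlows (fun i => (hφ i).contMDiff) contMDiff_id contMDiff_const
    have h0 : composeFlows φ 0 x = x := composeFlows_eq_self (fun i y => (hφ i y).1) x
    let D : (Fin k → ℂ) →L[ℂ] E :=
      mfderiv 𝓘(ℂ, Fin k → ℂ) 𝓘(ℂ, E) (fun v => composeFlows φ v x) 0
    -- The derivative at `0` of `t ↦ φ i t x` is computed twice: by the chain rule along the `i`-th
    -- axis, and from the flow equation.
    have hD (i : Fin k) : D (Pi.single i 1) = (ξ i x : E) := by
      let L : ℂ →L[ℂ] (Fin k → ℂ) := ContinuousLinearMap.single ℂ (fun _ => ℂ) i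
      have hL : HasMFDerivAt 𝓘(ℂ) 𝓘(ℂ, Fin k → ℂ) L 0 L :=
        hasMFDerivAt_iff_hasFDerivAt.2 L.hasFDerivAt
      have hL0 : L 0 = 0 := map_zero L
      have h1 : HasMFDerivAt 𝓘(ℂ, Fin k → ℂ) 𝓘(ℂ, E) (fun v => composeFlows φ v x) (L 0) D := by
        rw [hL0]
        exact (hsmooth.mdifferentiable (by simp) 0).hasMFDerivAt
      have h2 := h1.comp 0 hL
      have h3 : (fun v => composeFlows φ v x) ∘ L = fun t => φ i t x := by
        ext t
        exact composeFlows_single (fun i y => (hφ i y).1) i t x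
      rw [h3] at h2
      let w : E := ξ i (φ i 0 x)
      have hw : w = (ξ i x : E) := congrArg (fun z : X => (show E from ξ i z)) (hφ i x).1
      have h4 : D.comp L = (1 : ℂ →L[ℂ] ℂ).smulRight w :=
        hasMFDerivAt_unique (f := fun t => φ i t x) h2 ((hφ i x).2 0)
      have h5 := DFunLike.congr_fun h4 1
      simp only [ContinuousLinearMap.comp_apply, ContinuousLinearMap.smulRight_apply,
        one_apply_eq_self, one_smul] at h5
      exact h5.trans hw
    intro y
    obtain ⟨η, hη⟩ := hX x y
    obtain ⟨f, hf⟩ := hgen η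
    -- The preimage of `y` consists of the coefficients at `x` of a global field `η` with `η x = y`,
    -- written in the generators.
    refine ⟨fun i => f i x, ?_⟩
    have h1 : D (fun i => f i x) = ∑ i, f i x • (ξ i x : E) := by
      have := D.toLinearMap.pi_apply_eq_sum_univ (fun i => f i x)
      simp only [ContinuousLinearMap.coe_coe] at this
      rw [this]
      refine Finset.sum_congr rfl fun i _ => ?_
      rw [← hD]
      congr 2
      ext j
      simp [Pi.single_apply, eq_comm]
    exact h1.trans ((hf x).symm.trans hη)

end FlowSpray

theorem mainTheorem7
    {E : Type*} [NormedAddCommGroup E] [NormedSpace ℂ E] [FiniteDimensional ℂ E]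
    {X : Type*} [TopologicalSpace X] [T2Space X] [ChartedSpace E X] [IsManifold 𝓘(ℂ, E) ω X]
    {F : Type*} [NormedAddCommGroup F] [NormedSpace ℂ F] [FiniteDimensional ℂ F]
    {G : Type*} [CommGroup G] [TopologicalSpace G] [ChartedSpace F G] [LieGroup 𝓘(ℂ, F) ω G]
    [MulAction G X] [ContMDiffSMul 𝓘(ℂ, F) 𝓘(ℂ, E) ω G X]
    (hX : FieldsSpanTangentSpaces E X)
    {k : ℕ} (ξ : Fin k → HolVectorField E X) (χ : Fin k → G →* ℂˣ)
    (hχ : ∀ i, IsHolCharacter (F := F) (χ i))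
    (hcomplete : ∀ i, IsCompleteField (ξ i))
    (hweight : ∀ i, TransformsBy (χ i) (ξ i))
    (hgen : GenerateFields ξ) :
    IsGElliptic E F G X ∧
      ∃ φ : Fin k → ℂ → X → X, (∀ i, IsFlowOf (ξ i) (φ i)) ∧
        IsDominatingGSpray E F (twistedAction χ) (flowSpray φ) := by
  have : CompleteSpace E := FiniteDimensional.complete ℂ E
  choose γ hγ0 hγ using hcomplete
  -- The integral curves are chosen point by point; uniqueness of integral curves makes the choice
  -- harmless and the resulting flow holomorphic.
  let φ : Fin k → ℂ → X → X := fun i t x => γ i x t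
  have hφ (i : Fin k) : IsFlowOf (ξ i) (φ i) := fun x => ⟨hγ0 i x, hγ i x⟩
  have hsmul (g : G) : ContMDiff 𝓘(ℂ, E) 𝓘(ℂ, E) ω fun x : X => g • x :=
    (contMDiff_smul (I := 𝓘(ℂ, F)) (I' := 𝓘(ℂ, E)) (n := ω) (G := G) (M := X)).comp
      (contMDiff_const.prodMk contMDiff_id)
  have hspray : IsDominatingGSpray E F (twistedAction χ) (flowSpray φ) :=
    { lifted := isLiftedAction_twistedAction hχ
      spray := isDominatingSpray_flowSpray hX hgen hφ
      equivariant := fun g e => composeFlows_equivariant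
        (fun i t x => (hφ i).smul (hweight i) (hsmul g) t x) _ _ }
  exact ⟨⟨k, Bundle.Trivial X (Fin k → ℂ), inferInstance, inferInstance, inferInstance,
    inferInstance, inferInstance, inferInstance, inferInstance, twistedAction χ, flowSpray φ,
    hspray⟩, φ, hφ, hspray⟩
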